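/- **Theorem 5.2 (mode stability of the spacelike stretched warped AdS$_3$ black hole, without mirror).** Let $\nu>1$ and $0\le r_-<r_+$, and let the spacelike stretched black hole be given, in units $\ell=1$ and for $r>r_+$, by the metric $$ds^2=dt^2+\frac{dr^2}{4R^2N^2}+2R^2N^\theta\,dt\,d\theta+R^2d\theta^2,\qquad (t,r,\theta)\sim(t,r,\theta+2\pi),$$ $$R^2=\tfrac r4\big[3(\nu^2-1)r+(\nu^2+3)(r_++r_-)-4\nu\sqrt{r_+r_-(\nu^2+3)}\big],$$ $$N^2=\frac{(\nu^2+3)(r-r_+)(r-r_-)}{4R^2},\qquad N^\theta=\frac{2\nu r-\sqrt{r_+r_-(\nu^2+3)}}{2R^2}.$$ Let $m^2\in\mathbb R$ with $m^2\ge-\frac{\nu^2+3}{4}$ be the effective squared mass of a scalar field (bare mass plus curvature coupling). A *mode solution* of complex frequency $\omega\in\mathbb C$ and angular number $k\in\mathbb Z$ is a solution $\Phi=e^{-i\omega t+ik\theta}\phi(r)$ of $(\nabla^2-m^2)\Phi=0$ on $r>r_+$ with $\phi\in C^2((r_+,\infty),\mathbb C)$. Put $\varphi=R^{1/2}\phi$,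 $\frac{dr_*}{dr}=\frac1{2RN^2}$, $\tilde\omega=\omega+kN^\theta(r_+)$ and $\omega_m^2=\frac{(\nu^2+3)^2}{12(\nu^2-1)}\big(1+\frac{4m^2}{\nu^2+3}\big)$. Write $\varphi\sim e^{pr_*}$ at the horizon if, near $r_+$, $\varphi=e^{pr_*}h(r)$ with $h$ analytic at $r_+$ and $h(r_+)\ne0$; write $\varphi\sim e^{pr_*}$ at infinity if, for large $r$, $\varphi=e^{pr_*}h(1/r)$ with $h$ analytic at $0$ and $h(0)\neq0$. (Thus only the stated exponential branch is present.) A mode solution is * a *quasinormal mode* if $\varphi\sim e^{-i\tilde\omega r_*}$ at the horizon (ingoing) and $\varphi\sim e^{i\hat\omega r_*}$ at infinity (outgoing) for some $\hat\omega\in\mathbb C$ with $\hat\omega^2=\omega^2-\omega_m^2$ and with $\operatorname{Re}\hat\omega$ nonzero and of the same sign as $\operatorname{Re}\omega\neq0$; * a *bound state mode* if $\varphi\sim e^{-i\tilde\omega r_*}$ at the horizon and $\varphi\sim e^{-\hat\varpi r_*}$ at infinity for some $\hat\varpi\in\mathbb C$ with $\hat\varpi^2=\omega_m^2-\omega^2$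 and $\operatorname{Re}\hat\varpi>0$ (exponentially decreasing). Then every quasinormal mode and every bound state mode has $\operatorname{Im}\omega<0$. That is, the black hole is linearly mode-stable to massive scalar perturbations; in particular no such mode is non-decaying in time, and there is no superradiant instability. -/

import Mathlib

open Filter Topology

noncomputable section

/-- Parameters of a non-extremal spacelike stretched warped AdS₃ black hole, in units `ℓ = 1`:
warp factor `ν > 1`, outer horizon radius `rp` and inner horizon radius `rm`. -/
structure StretchedBH where
  ν : ℝ
  rp : ℝ
  rm : ℝ
  one_lt_ν : 1 < ν
  rm_nonneg : 0 ≤ rm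
  rm_lt_rp : rm < rp

namespace StretchedBH

variable (B : StretchedBH)

/-- `R(r)²`. -/
def Rsq (r : ℝ) : ℝ :=
  r / 4 * (3 * (B.ν ^ 2 - 1) * r + (B.ν ^ 2 + 3) * (B.rp + B.rm)
    - 4 * B.ν * √(B.rp * B.rm * (B.ν ^ 2 + 3)))

/-- `R(r)`, positive for `r ≥ r₊`. -/
def R (r : ℝ) : ℝ := √(B.Rsq r)

/-- `N(r)²`. -/
def Nsq (r : ℝ) : ℝ :=
  (B.ν ^ 2 + 3) * (r - B.rp) * (r - B.rm) / (4 * B.Rsq r)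

/-- The angular shift `N^θ(r)`. -/
def Nθ (r : ℝ) : ℝ :=
  (2 * B.ν * r - √(B.rp * B.rm * (B.ν ^ 2 + 3))) / (2 * B.Rsq r)

/-- The metric
`ds² = dt² + dr² / (4 R² N²) + 2 R² N^θ dt dθ + R² dθ²`
at the point with coordinates `x = (t, r, θ)`, indexed by `0, 1, 2`. -/
def metric (x : Fin 3 → ℝ) : Matrix (Fin 3) (Fin 3) ℝ :=
  !![1, 0, B.Rsq (x 1) * B.Nθ (x 1);
     0, 1 / (4 * B.Rsq (x 1) * B.Nsq (x 1)), 0;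
     B.Rsq (x 1) * B.Nθ (x 1), 0, B.Rsq (x 1)]

/-- The coordinate partial derivative `∂F/∂x^μ`. -/
def pderiv (μ : Fin 3) (F : (Fin 3 → ℝ) → ℂ) (x : Fin 3 → ℝ) : ℂ :=
  deriv (fun s : ℝ => F (Function.update x μ s)) (x μ)

/-- The wave operator `∇² Φ = |g|^{-1/2} ∂_μ (|g|^{1/2} g^{μν} ∂_ν Φ)`. -/
def box (Φ : (Fin 3 → ℝ) → ℂ) (x : Fin 3 → ℝ) : ℂ :=
  ((√|(B.metric x).det| : ℝ) : ℂ)⁻¹ *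
    ∑ μ : Fin 3, pderiv μ (fun y =>
      ∑ κ : Fin 3,
        ((√|(B.metric y).det| * (B.metric y)⁻¹ μ κ : ℝ) : ℂ) * pderiv κ Φ y) x

/-- The field `e^{-iωt + ikθ} φ(r)`. -/
def modeField (ω : ℂ) (k : ℤ) (φ : ℝ → ℂ) (x : Fin 3 → ℝ) : ℂ :=
  Complex.exp (-Complex.I * ω * (x 0 : ℂ) + Complex.I * (k : ℂ) * (x 2 : ℂ)) * φ (x 1)

/-- `e^{-iωt + ikθ} φ(r)` is a mode solution of `(∇² - m²) Φ = 0` in the exterior `r > r₊`;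
`msq` is the effective squared mass `m²`. -/
def IsModeSolution (msq : ℝ) (ω : ℂ) (k : ℤ) (φ : ℝ → ℂ) : Prop :=
  ContDiffOn ℝ 2 φ (Set.Ioi B.rp) ∧
  ∀ x : Fin 3 → ℝ, B.rp < x 1 →
    B.box (modeField ω k φ) x - (msq : ℂ) * modeField ω k φ x = 0

/-- The tortoise coordinate `r_*` on the exterior region, `dr_*/dr = 1 / (2 R N²)`. The base
point `r₊ + 1` only fixes the additive constant. -/
def tortoise (r : ℝ) : ℝ :=
  ∫ s in (B.rp + 1)..r, 1 / (2 * B.R s * B.Nsq s)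

/-- The rescaled radial function `R(r)^{1/2} φ(r)`. -/
def rescaled (φ : ℝ → ℂ) (r : ℝ) : ℂ := ((√(B.R r) : ℝ) : ℂ) * φ r

/-- The co-rotating frequency `ω + k N^θ(r₊) = ω - k Ω_H`. -/
def omegaTilde (ω : ℂ) (k : ℤ) : ℂ := ω + (k : ℂ) * (B.Nθ B.rp : ℂ)

/-- `ω_m²`, the limit of the effective potential at infinity. -/
def omegaMsq (msq : ℝ) : ℝ :=
  (B.ν ^ 2 + 3) ^ 2 / (12 * (B.ν ^ 2 - 1)) * (1 + 4 * msq / (B.ν ^ 2 + 3))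

/-- Purely `e^{p r_*}` behaviour at the horizon: there the rescaled radial function is
`e^{p r_*}` times an amplitude that is analytic up to and including `r = r₊`, and does not vanish
at `r₊`. The radial equation has a regular singular point at `r₊`, so the amplitude of a pure
branch is a power series in `r - r₊`. Demanding this, and not just the leading behaviour, excludes
an admixture of the other branch also when that one is exponentially subdominant. -/
def PureAtHorizon (φ : ℝ → ℂ) (p : ℂ) : Prop :=
  ∃ h : ℝ → ℂ, AnalyticAt ℝ h B.rp ∧ h B.rp ≠ 0 ∧
    ∀ᶠ r in 𝓝[>] B.rp, B.rescaled φ r = Complex.exp (p * (B.tortoise r : ℂ)) * h r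

/-- Purely `e^{p r_*}` behaviour at spatial infinity: for large `r` the rescaled radial function
is `e^{p r_*}` times an amplitude analytic in `1 / r` at `1 / r = 0`, with nonzero limit. Infinity
is a regular singular point too. -/
def PureAtInfinity (φ : ℝ → ℂ) (p : ℂ) : Prop :=
  ∃ h : ℝ → ℂ, AnalyticAt ℝ h 0 ∧ h 0 ≠ 0 ∧
    ∀ᶠ r in atTop, B.rescaled φ r = Complex.exp (p * (B.tortoise r : ℂ)) * h r⁻¹

/-- A quasinormal mode of complex frequency `ω`: only the ingoing wave `e^{-i ω̃ r_*}` at the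
horizon and only the outgoing wave `e^{i ω̂ r_*}` at infinity. Here `ω̂² = ω² - ω_m²`, and the
wave is outgoing when `Re ω̂` is nonzero and has the sign of `Re ω`. -/
def IsQuasinormalMode (msq : ℝ) (ω : ℂ) (k : ℤ) (φ : ℝ → ℂ) : Prop :=
  B.IsModeSolution msq ω k φ ∧
  B.PureAtHorizon φ (-Complex.I * B.omegaTilde ω k) ∧
  ∃ ωhat : ℂ, ωhat ^ 2 = ω ^ 2 - (B.omegaMsq msq : ℂ) ∧ 0 < ω.re * ωhat.re ∧
    B.PureAtInfinity φ (Complex.I * ωhat)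

/-- A bound state mode of complex frequency `ω`: only the ingoing wave `e^{-i ω̃ r_*}` at the
horizon and only the exponentially decreasing branch `e^{-ϖ r_*}` at infinity, where
`ϖ² = ω_m² - ω²` and `Re ϖ > 0`. -/
def IsBoundStateMode (msq : ℝ) (ω : ℂ) (k : ℤ) (φ : ℝ → ℂ) : Prop :=
  B.IsModeSolution msq ω k φ ∧
  B.PureAtHorizon φ (-Complex.I * B.omegaTilde ω k) ∧
  ∃ ϖ : ℂ, ϖ ^ 2 = (B.omegaMsq msq : ℂ) - ω ^ 2 ∧ 0 < ϖ.re ∧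
    B.PureAtInfinity φ (-ϖ)

end StretchedBH

end

/-! ### Integration on a half-line and the moment problem. -/

noncomputable section

open MeasureTheory Set

/-! Separating variables leaves a radial equation `(Δ φ')' + (V - m²) φ = 0` with `Δ = (ν² + 3)(r -
r₊)(r - r₋)`. Its singular points `r₊`, `r₋`, `∞` are all regular, so it is of hypergeometric type.
Assume `Im ω ≥ 0` and let `p` be the exponent at infinity; for both kinds of mode `Re p ≤ 0`.

Let `x = (r - r₊)/(r - r₋)`, and let `g = (r - r₊)^λ (r - r₋)^τ` have the same leading exponents as
`φ` at both ends. The radial operator sends `g x^n` to a combination of `g x^n/(r - r₋)` and `g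
x^(n-1)/(r - r₋)`. The Wronskian of `φ` with `g x^n` vanishes at both ends, because the logarithmic
derivatives agree there to leading order; hence real `ω` is covered too. Integrating its derivative
(`hasDerivAt_wronskian`) gives, for the moments `M_n = ∫ φ g x^n/(r - r₋)`, the recursion `((1/2 + β
+ λ + n)² + γ²) M_n = n (n + 2λ) M_(n-1)`.

The left factor splits into two factors whose real parts are at least `1/2` when `Im ω ≥ 0`. The
right side vanishes at `n = 0`, so every moment is zero. By Weierstrass approximation
(`eq_zero_of_moments`) `φ = 0`, contradicting the nonzero amplitude at the horizon. The pairing is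
bilinear, without complex conjugation, so no sign of an energy flux enters and superradiance is no
obstacle. -/

/-- The fundamental theorem of calculus on `(a, ∞)` for a function vanishing at both ends. -/
lemma integral_Ioi_eq_zero_of_hasDerivAt {a : ℝ} {f f' : ℝ → ℂ}
    (hf : ∀ r ∈ Ioi a, HasDerivAt f (f' r) r) (hint : IntegrableOn f' (Ioi a))
    (ha : Tendsto f (𝓝[>] a) (𝓝 0)) (hinf : Tendsto f atTop (𝓝 0)) :
    ∫ r in Ioi a, f' r = 0 := by
  -- The value of `f` at `a` is arbitrary; replacing it by the limit `0` gives the continuity at the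
  -- endpoint that the fundamental theorem needs.
  have hne : ∀ r ∈ Ioi a, Function.update f a 0 =ᶠ[𝓝 r] f := fun r hr => by
    filter_upwards [isOpen_ne.mem_nhds (ne_of_gt hr : r ≠ a)] with t ht
    exact Function.update_of_ne ht _ _
  have h := integral_Ioi_of_hasDerivAt_of_tendsto (f := Function.update f a 0) (a := a) (m := 0)
    ?_ (fun r hr => (hf r hr).congr_of_eventuallyEq (hne r hr)) hint
    (hinf.congr' ?_)
  · simpa using h
  · rw [← continuousWithinAt_Ioi_iff_Ici, continuousWithinAt_update_same]
    simpa using ha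
  · filter_upwards [eventually_gt_atTop a] with r hr using ((hne r hr).self_of_nhds).symm

/-- A function on `(a, ∞)` whose moments against the powers of `(r - a) / (r - b)`, `b < a`, all
vanish is zero. -/
lemma eq_zero_of_moments {a b : ℝ} (hab : b < a) {H : ℝ → ℂ} (hc : ContinuousOn H (Ioi a))
    (hint : IntegrableOn H (Ioi a))
    (hmom : ∀ n : ℕ, ∫ r in Ioi a, H r * (((r - a) / (r - b) : ℝ) : ℂ) ^ n = 0) :
    ∀ r ∈ Ioi a, H r = 0 := by
  set X : ℝ → ℝ := fun r => (r - a) / (r - b) with hX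
  have hX01 : ∀ r ∈ Ioi a, X r ∈ Ico (0 : ℝ) 1 := fun r hr => by
    have h1 : 0 < r - b := by linarith [mem_Ioi.1 hr]
    refine ⟨div_nonneg (by linarith [mem_Ioi.1 hr]) h1.le, (div_lt_one h1).2 (by linarith)⟩
  have hXc : ContinuousOn X (Ioi a) := by
    refine ContinuousOn.div (by fun_prop) (by fun_prop) fun r hr => ?_
    linarith [mem_Ioi.1 hr]
  have hmeas : ∀ n : ℕ, AEStronglyMeasurable (fun r => ((X r : ℝ) : ℂ) ^ n)
      (volume.restrict (Ioi a)) := fun n =>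
    ((Complex.continuous_ofReal.comp_continuousOn hXc).pow n).aestronglyMeasurable
      measurableSet_Ioi
  have hpowint : ∀ n : ℕ, IntegrableOn (fun r => H r * ((X r : ℝ) : ℂ) ^ n) (Ioi a) := by
    intro n
    refine hint.mul_bdd (c := 1) (hmeas n) ?_
    filter_upwards [ae_restrict_mem measurableSet_Ioi] with r hr
    rw [norm_pow, Complex.norm_real, Real.norm_eq_abs, abs_of_nonneg (hX01 r hr).1]
    exact pow_le_one₀ (hX01 r hr).1 (hX01 r hr).2.le
  have hpoly : ∀ p : Polynomial ℝ,
      IntegrableOn (fun r => H r * ((p.eval (X r) : ℝ) : ℂ)) (Ioi a) ∧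
      ∫ r in Ioi a, H r * ((p.eval (X r) : ℝ) : ℂ) = 0 := by
    intro p
    induction p using Polynomial.induction_on' with
    | add p q hp hq =>
      simp only [Polynomial.eval_add, Complex.ofReal_add, mul_add]
      exact ⟨hp.1.add hq.1, by rw [integral_add hp.1 hq.1, hp.2, hq.2, add_zero]⟩
    | monomial n c =>
      have : ∀ r, H r * (((Polynomial.monomial n c).eval (X r) : ℝ) : ℂ)
          = c * (H r * ((X r : ℝ) : ℂ) ^ n) := fun r => by
        rw [Polynomial.eval_monomial]
        push_cast
        ring
      simp only [this]
      exact ⟨(hpowint n).const_mul _, by rw [integral_const_mul, hmom n, mul_zero]⟩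
  have hcont : ∀ ψ : ℝ → ℝ, ContinuousOn ψ (Icc 0 1) →
      ∫ r in Ioi a, H r * ((ψ (X r) : ℝ) : ℂ) = 0 := by
    intro ψ hψ
    have hψX : ContinuousOn (fun r => ((ψ (X r) : ℝ) : ℂ)) (Ioi a) :=
      Complex.continuous_ofReal.comp_continuousOn
        (hψ.comp hXc fun r hr => Ico_subset_Icc_self (hX01 r hr))
    obtain ⟨C, hC⟩ := isCompact_Icc.exists_bound_of_continuousOn hψ
    have hψint : IntegrableOn (fun r => H r * ((ψ (X r) : ℝ) : ℂ)) (Ioi a) := by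
      refine hint.mul_bdd (c := C) (hψX.aestronglyMeasurable measurableSet_Ioi) ?_
      filter_upwards [ae_restrict_mem measurableSet_Ioi] with r hr
      rw [Complex.norm_real]
      exact hC _ (Ico_subset_Icc_self (hX01 r hr))
    set M := ∫ r in Ioi a, ‖H r‖
    have hM : 0 ≤ M := integral_nonneg fun r => norm_nonneg _
    refine norm_le_zero_iff.1 (le_of_forall_pos_le_add fun ε hε => ?_)
    -- Dividing by `M + 1` rather than `M` allows for `M = 0`.
    obtain ⟨p, hp⟩ := exists_polynomial_near_of_continuousOn 0 1 ψ hψ (ε / (M + 1))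
      (by positivity)
    have h1 : ∫ r in Ioi a, H r * ((ψ (X r) : ℝ) : ℂ)
        = ∫ r in Ioi a, (H r * ((ψ (X r) : ℝ) : ℂ) - H r * ((p.eval (X r) : ℝ) : ℂ)) := by
      rw [integral_sub hψint (hpoly p).1, (hpoly p).2, sub_zero]
    rw [h1, zero_add]
    calc ‖∫ r in Ioi a, (H r * ((ψ (X r) : ℝ) : ℂ) - H r * ((p.eval (X r) : ℝ) : ℂ))‖
        ≤ ∫ r in Ioi a, (ε / (M + 1)) * ‖H r‖ := by
          refine norm_integral_le_of_norm_le (hint.norm.const_mul _) ?_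
          filter_upwards [ae_restrict_mem measurableSet_Ioi] with r hr
          rw [← mul_sub, norm_mul, mul_comm, ← Complex.ofReal_sub, Complex.norm_real,
            Real.norm_eq_abs, abs_sub_comm]
          gcongr
          exact (hp _ (Ico_subset_Icc_self (hX01 r hr))).le
      _ = ε * (M / (M + 1)) := by rw [integral_const_mul]; ring
      _ ≤ ε * 1 := by
          gcongr
          exact (div_le_one (by positivity)).2 (by linarith)
      _ = ε := mul_one ε
  have hae : ∀ᵐ r, r ∈ Ioi a → H r = 0 := by
    refine isOpen_Ioi.ae_eq_zero_of_integral_contDiff_smul_eq_zero hint.locallyIntegrableOn ?_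
    intro g hg hgc hgs
    -- A test function `g` is rewritten as a function of `x`, through the inverse `t ↦ b + (a -
    -- b)/(1 - t)` of `r ↦ (r - a)/(r - b)`.
    set ψ : ℝ → ℝ := fun t => g (b + (a - b) / (1 - t)) with hψdef
    have hψX : ∀ r ∈ Ioi a, ψ (X r) = g r := fun r hr => by
      have h1 : r - b ≠ 0 := by linarith [mem_Ioi.1 hr]
      have h2 : a - b ≠ 0 := by linarith
      simp only [hψdef, hX]
      congr 1
      rw [show 1 - (r - a) / (r - b) = (a - b) / (r - b) by field_simp; ring]
      field_simp
      ring
    have hψ : ContinuousOn ψ (Icc 0 1) := by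
      intro t ht
      rcases ht.2.eq_or_lt with rfl | ht1
      · have h1 : Tendsto (fun t : ℝ => b + (a - b) / (1 - t)) (𝓝[<] 1) atTop := by
          refine tendsto_atTop_add_const_left _ _ ?_
          refine Tendsto.const_mul_atTop (by linarith : 0 < a - b) ?_
          refine tendsto_inv_nhdsGT_zero.comp (tendsto_nhdsWithin_iff.2 ⟨?_, ?_⟩)
          · have : Tendsto (fun t : ℝ => 1 - t) (𝓝 1) (𝓝 (1 - 1)) := by
              exact (continuous_const.sub continuous_id).tendsto 1
            rw [sub_self] at this
            exact this.mono_left nhdsWithin_le_nhds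
          · filter_upwards [self_mem_nhdsWithin] with t ht
            simpa using ht
        have h2 : ∀ᶠ r in atTop, g r = 0 := by
          have := hgc.isCompact.bddAbove
          obtain ⟨m, hm⟩ := this
          filter_upwards [eventually_gt_atTop m] with r hr
          exact image_eq_zero_of_notMem_tsupport fun h => absurd (hm h) (not_le.2 hr)
        have h3 : ∀ᶠ t in 𝓝[<] (1 : ℝ), ψ t = 0 := h1.eventually h2
        -- Since `(a - b)/0 = 0`, the value at `t = 1` is `g b`, and `b < a` lies outside the
        -- support. It agrees with the limit from the left, where `r → ∞` leaves the support.
        have h4 : ψ 1 = 0 := by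
          simp only [hψdef, sub_self, div_zero, add_zero]
          exact image_eq_zero_of_notMem_tsupport fun h => absurd (hgs h) (by simpa using hab.le)
        have h5 : ContinuousWithinAt ψ (Iio 1) 1 := by
          rw [ContinuousWithinAt, h4]
          exact tendsto_const_nhds.congr' (h3.mono fun t ht => ht.symm)
        exact (continuousWithinAt_Iio_iff_Iic.1 h5).mono fun t ht => ht.2
      · refine ContinuousAt.continuousWithinAt ?_
        refine hg.continuous.continuousAt.comp ?_
        refine continuousAt_const.add (continuousAt_const.div (by fun_prop) (by linarith))
    rw [← hcont ψ hψ, ← integral_indicator measurableSet_Ioi]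
    congr 1
    ext r
    by_cases hr : r ∈ Ioi a
    · rw [indicator_of_mem hr, hψX r hr, Complex.real_smul, mul_comm]
    · rw [indicator_of_notMem hr, image_eq_zero_of_notMem_tsupport fun h => hr (hgs h), zero_smul]
  have hae' : H =ᵐ[volume.restrict (Ioi a)] 0 := (ae_restrict_iff' measurableSet_Ioi).2 hae
  exact Measure.eqOn_open_of_ae_eq hae' isOpen_Ioi hc continuousOn_const

end

/-! ### Algebra of the metric functions. -/

noncomputable section

namespace StretchedBH

variable (B : StretchedBH)

/-- The constant `√(r₊ r₋ (ν² + 3))`. -/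
def shift : ℝ := √(B.rp * B.rm * (B.ν ^ 2 + 3))

/-- The radial coefficient `4 R² N² = (ν² + 3) (r - r₊) (r - r₋)` of the wave operator. -/
def radialCoeff (r : ℝ) : ℝ := (B.ν ^ 2 + 3) * (r - B.rp) * (r - B.rm)

lemma rp_pos : 0 < B.rp := B.rm_nonneg.trans_lt B.rm_lt_rp

lemma warp_pos : 0 < B.ν ^ 2 + 3 := by positivity

lemma gap_pos : 0 < B.rp - B.rm := sub_pos.2 B.rm_lt_rp

lemma stretch_pos : 0 < 3 * (B.ν ^ 2 - 1) := by
  have := B.one_lt_ν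
  nlinarith

lemma shift_sq : B.shift ^ 2 = B.rp * B.rm * (B.ν ^ 2 + 3) :=
  Real.sq_sqrt (mul_nonneg (mul_nonneg B.rp_pos.le B.rm_nonneg) B.warp_pos.le)

lemma shift_lt : B.shift < 2 * B.ν * B.rp := by
  have h1 := B.stretch_pos
  have h2 := B.rp_pos
  have h3 : 0 < B.ν := by linarith [B.one_lt_ν]
  refine lt_of_pow_lt_pow_left₀ 2 (by positivity) ?_
  rw [B.shift_sq]
  have h4 : B.rp * B.rm * (B.ν ^ 2 + 3) ≤ B.rp * B.rp * (B.ν ^ 2 + 3) := by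
    have := B.rm_lt_rp
    have := B.warp_pos
    gcongr
  nlinarith [mul_pos h1 (mul_pos h2 h2)]

/-- The difference of the squares is `ν² (r₊ - r₋)² + 3 (ν² - 1) r₊ r₋`. The inequality gives the
sign of `Im (α + γ)` in the moment recursion. -/
lemma shift_lt_sum : B.shift < B.ν * (B.rp + B.rm) := by
  have h1 := B.stretch_pos
  have h2 := B.rp_pos
  have h5 := B.rm_nonneg
  have h3 : 0 < B.ν := by linarith [B.one_lt_ν]
  refine lt_of_pow_lt_pow_left₀ 2 (by positivity) ?_
  rw [B.shift_sq]
  have h6 : 0 < B.ν ^ 2 * (B.rp - B.rm) ^ 2 := by have := B.gap_pos; positivity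
  nlinarith [mul_nonneg h1.le (mul_nonneg h2.le h5)]

lemma radialCoeff_pos {r : ℝ} (hr : B.rp < r) : 0 < B.radialCoeff r :=
  mul_pos (mul_pos B.warp_pos (sub_pos.2 hr)) (sub_pos.2 (B.rm_lt_rp.trans hr))

/-- At both zeros of `radialCoeff`, `4 R²` is thus a perfect square. This yields `R` at the horizon
and the squared residues of the potential. -/
lemma four_mul_Rsq (r : ℝ) : 4 * B.Rsq r = (2 * B.ν * r - B.shift) ^ 2 - B.radialCoeff r := by
  have h := B.shift_sq
  unfold Rsq radialCoeff
  rw [← shift]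
  linear_combination -h

lemma Rsq_pos {r : ℝ} (hr : B.rp ≤ r) : 0 < B.Rsq r := by
  have h0 := B.rp_pos
  have h1 := B.four_mul_Rsq B.rp
  have h2 : 0 < (2 * B.ν * B.rp - B.shift) ^ 2 := by
    have := sub_pos.2 B.shift_lt
    positivity
  have h3 : 0 < 3 * (B.ν ^ 2 - 1) * B.rp + (B.ν ^ 2 + 3) * (B.rp + B.rm)
      - 4 * B.ν * √(B.rp * B.rm * (B.ν ^ 2 + 3)) := by
    have h4 : 0 < B.Rsq B.rp := by
      have : B.radialCoeff B.rp = 0 := by simp [radialCoeff]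
      linarith
    exact pos_of_mul_pos_right h4 (by positivity)
  -- The bracket in `Rsq` is increasing in `r`, so its positivity propagates from `r₊`.
  have h5 := mul_le_mul_of_nonneg_left hr B.stretch_pos.le
  exact mul_pos (by linarith) (by linarith)

lemma R_pos {r : ℝ} (hr : B.rp ≤ r) : 0 < B.R r := Real.sqrt_pos.2 (B.Rsq_pos hr)

lemma R_sq {r : ℝ} (hr : B.rp ≤ r) : B.R r ^ 2 = B.Rsq r := Real.sq_sqrt (B.Rsq_pos hr).le

lemma two_mul_R_rp : 2 * B.R B.rp = 2 * B.ν * B.rp - B.shift := by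
  have h1 := B.R_pos le_rfl
  have h2 := B.shift_lt
  refine (pow_left_inj₀ (by positivity) (by linarith) two_ne_zero).1 ?_
  have h3 := B.four_mul_Rsq B.rp
  have : B.radialCoeff B.rp = 0 := by simp [radialCoeff]
  rw [mul_pow, B.R_sq le_rfl]
  linarith

lemma Rsq_mul_Nsq {r : ℝ} (hr : B.rp ≤ r) : 4 * B.Rsq r * B.Nsq r = B.radialCoeff r := by
  have := (B.Rsq_pos hr).ne'
  unfold Nsq radialCoeff
  field_simp

lemma Nsq_pos {r : ℝ} (hr : B.rp < r) : 0 < B.Nsq r := by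
  have := B.Rsq_pos hr.le
  exact div_pos (B.radialCoeff_pos hr) (by positivity)

lemma two_Rsq_mul_Nθ {r : ℝ} (hr : B.rp ≤ r) :
    2 * B.Rsq r * B.Nθ r = 2 * B.ν * r - B.shift := by
  have := (B.Rsq_pos hr).ne'
  unfold Nθ
  rw [← shift]
  field_simp

lemma Rsq_mul_Nθ_sq {r : ℝ} (hr : B.rp ≤ r) : B.Rsq r * B.Nθ r ^ 2 = 1 + B.Nsq r := by
  have h0 := (B.Rsq_pos hr).ne'
  have h1 := B.two_Rsq_mul_Nθ hr
  have h2 := B.four_mul_Rsq r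
  have h3 := B.Rsq_mul_Nsq hr
  apply mul_left_cancel₀ h0
  rw [← h1] at h2
  linear_combination (-1 / 4) * h3 - (1 / 4) * h2

/-- The inverse metric on the exterior. -/
def invMetric (r : ℝ) : Matrix (Fin 3) (Fin 3) ℝ :=
  !![-1 / B.Nsq r, 0, B.Nθ r / B.Nsq r;
     0, B.radialCoeff r, 0;
     B.Nθ r / B.Nsq r, 0, -1 / (B.Rsq r * B.Nsq r)]

lemma metric_inv {x : Fin 3 → ℝ} (hx : B.rp < x 1) : (B.metric x)⁻¹ = B.invMetric (x 1) := by
  have h1 := (B.Rsq_pos hx.le).ne'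
  have h2 := (B.Nsq_pos hx).ne'
  have h3 := B.Rsq_mul_Nθ_sq hx.le
  apply Matrix.inv_eq_right_inv
  rw [metric, invMetric, ← B.Rsq_mul_Nsq hx.le]
  ext i j
  fin_cases i <;> fin_cases j <;> simp [Matrix.mul_apply, Fin.sum_univ_three] <;> field_simp <;>
    first | ring1 | linear_combination h3

/-- The determinant is constant, so the volume density drops out of the wave operator. -/
lemma metric_det {x : Fin 3 → ℝ} (hx : B.rp < x 1) : (B.metric x).det = -1 / 4 := by
  have h1 := (B.Rsq_pos hx.le).ne'
  have h2 := (B.Nsq_pos hx).ne'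
  have h3 := B.Rsq_mul_Nθ_sq hx.le
  simp [metric, Matrix.det_fin_three]
  field_simp
  linear_combination -h3

lemma sqrt_metric_det {x : Fin 3 → ℝ} (hx : B.rp < x 1) : √|(B.metric x).det| = 1 / 2 := by
  rw [B.metric_det hx, show |(-1 / 4 : ℝ)| = (1 / 2) ^ 2 by norm_num [abs_of_neg]]
  exact Real.sqrt_sq (by norm_num)

/-! ### Separation of variables. -/

variable {B}

lemma pderiv_zero_modeField (ω : ℂ) (k : ℤ) (φ : ℝ → ℂ) (y : Fin 3 → ℝ) :
    pderiv 0 (modeField ω k φ) y = -Complex.I * ω * modeField ω k φ y := by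
  have h : HasDerivAt (fun s : ℝ => -Complex.I * ω * (s : ℂ) + Complex.I * (k : ℂ) * (y 2 : ℂ))
      (-Complex.I * ω * 1) (y 0) :=
    (Complex.ofRealCLM.hasDerivAt.const_mul _).add_const _
  have h' := (h.cexp.mul_const (φ (y 1))).deriv
  simp only [pderiv, modeField, Function.update_self, ne_eq, Fin.reduceEq, not_false_eq_true,
    Function.update_of_ne] at h' ⊢
  rw [h']
  ring

lemma pderiv_two_modeField (ω : ℂ) (k : ℤ) (φ : ℝ → ℂ) (y : Fin 3 → ℝ) :
    pderiv 2 (modeField ω k φ) y = Complex.I * k * modeField ω k φ y := by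
  have h : HasDerivAt (fun s : ℝ => -Complex.I * ω * (y 0 : ℂ) + Complex.I * (k : ℂ) * (s : ℂ))
      (Complex.I * k * 1) (y 2) :=
    (Complex.ofRealCLM.hasDerivAt.const_mul _).const_add _
  have h' := (h.cexp.mul_const (φ (y 1))).deriv
  simp only [pderiv, modeField, Function.update_self, ne_eq, Fin.reduceEq, not_false_eq_true,
    Function.update_of_ne] at h' ⊢
  rw [h']
  ring

lemma pderiv_one_modeField (ω : ℂ) (k : ℤ) (φ : ℝ → ℂ) (y : Fin 3 → ℝ) :
    pderiv 1 (modeField ω k φ) y = modeField ω k (deriv φ) y := by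
  simp only [pderiv, modeField, Function.update_self, ne_eq, Fin.reduceEq, not_false_eq_true,
    Function.update_of_ne]
  exact deriv_const_mul_field _

/-- The exterior is open, so formulas for the metric valid only there may be used under a partial
derivative. -/
lemma pderiv_congr {F G : (Fin 3 → ℝ) → ℂ} (h : ∀ y : Fin 3 → ℝ, B.rp < y 1 → F y = G y)
    {x : Fin 3 → ℝ} (hx : B.rp < x 1) (μ : Fin 3) : pderiv μ F x = pderiv μ G x := by
  refine Filter.EventuallyEq.deriv_eq ?_
  have hc : ContinuousAt (fun s : ℝ => Function.update x μ s 1) (x μ) := by fun_prop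
  have := hc.eventually_const_lt (u := B.rp) (by simpa using hx)
  filter_upwards [this] with s hs using h _ hs

variable (B) in
/-- The numerator `4 R² ω² + 8 R² N^θ ω k + 4 k²` of the frequency-dependent potential. -/
def freqPoly (ω : ℂ) (k : ℤ) (r : ℝ) : ℂ :=
  4 * (B.Rsq r : ℂ) * ω ^ 2 + 4 * ω * k * (2 * B.ν * r - B.shift) + 4 * k ^ 2

lemma box_modeField (ω : ℂ) (k : ℤ) (φ : ℝ → ℂ) {x : Fin 3 → ℝ} (hx : B.rp < x 1) :
    B.box (modeField ω k φ) x = modeField ω k (fun r =>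
      deriv (fun r => (B.radialCoeff r : ℂ) * deriv φ r) r
        + B.freqPoly ω k r / B.radialCoeff r * φ r) x := by
  have key : ∀ μ : Fin 3, ∀ y : Fin 3 → ℝ, B.rp < y 1 →
      ∑ κ : Fin 3, ((√|(B.metric y).det| * (B.metric y)⁻¹ μ κ : ℝ) : ℂ) *
        pderiv κ (modeField ω k φ) y = modeField ω k (fun r =>
          (1 / 2) * (B.invMetric r μ 0 * (-Complex.I * ω) * φ r + B.invMetric r μ 1 * deriv φ r
            + B.invMetric r μ 2 * (Complex.I * k) * φ r)) y := by
    intro μ y hy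
    rw [B.sqrt_metric_det hy, B.metric_inv hy, Fin.sum_univ_three, pderiv_zero_modeField,
      pderiv_one_modeField, pderiv_two_modeField]
    simp only [modeField]
    push_cast
    ring
  rw [box, B.sqrt_metric_det hx, Fin.sum_univ_three, pderiv_congr (key 0) hx,
    pderiv_congr (key 1) hx, pderiv_congr (key 2) hx, pderiv_zero_modeField,
    pderiv_one_modeField, pderiv_two_modeField]
  have hd : deriv (fun r : ℝ => (1 / 2 : ℂ) * (B.invMetric r 1 0 * (-Complex.I * ω) * φ r
      + B.invMetric r 1 1 * deriv φ r + B.invMetric r 1 2 * (Complex.I * k) * φ r)) (x 1)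
      = 1 / 2 * deriv (fun r => (B.radialCoeff r : ℂ) * deriv φ r) (x 1) := by
    simp [invMetric]
  simp only [modeField]
  rw [hd]
  have h1 : (B.Rsq (x 1) : ℂ) ≠ 0 := by exact_mod_cast (B.Rsq_pos hx.le).ne'
  have h2 : (B.Nsq (x 1) : ℂ) ≠ 0 := by exact_mod_cast (B.Nsq_pos hx).ne'
  have h3 : (2 * B.Rsq (x 1) * B.Nθ (x 1) : ℂ) = 2 * B.ν * (x 1 : ℝ) - B.shift := by
    exact_mod_cast B.two_Rsq_mul_Nθ hx.le
  rw [freqPoly, ← h3, ← B.Rsq_mul_Nsq hx.le]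
  simp [invMetric]
  field_simp
  ring_nf
  simp only [Complex.I_sq]
  ring

/-- The radial equation satisfied by the radial part of a mode solution. -/
lemma IsModeSolution.radial_eq {msq : ℝ} {ω : ℂ} {k : ℤ} {φ : ℝ → ℂ}
    (h : B.IsModeSolution msq ω k φ) {r : ℝ} (hr : B.rp < r) :
    deriv (fun r => (B.radialCoeff r : ℂ) * deriv φ r) r
        + (B.freqPoly ω k r / B.radialCoeff r - msq) * φ r = 0 := by
  have h1 := h.2 ![0, r, 0] (by simpa using hr)
  rw [box_modeField ω k φ (by simpa using hr)] at h1
  simp only [modeField, Matrix.cons_val] at h1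
  simp at h1
  linear_combination h1

lemma IsModeSolution.hasDerivAt {msq : ℝ} {ω : ℂ} {k : ℤ} {φ : ℝ → ℂ}
    (h : B.IsModeSolution msq ω k φ) {r : ℝ} (hr : B.rp < r) :
    HasDerivAt φ (deriv φ r) r :=
  ((h.1.differentiableOn (by norm_num)).differentiableAt (Ioi_mem_nhds hr)).hasDerivAt

lemma IsModeSolution.hasDerivAt_flux {msq : ℝ} {ω : ℂ} {k : ℤ} {φ : ℝ → ℂ}
    (h : B.IsModeSolution msq ω k φ) {r : ℝ} (hr : B.rp < r) :
    HasDerivAt (fun r => (B.radialCoeff r : ℂ) * deriv φ r)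
      (-(B.freqPoly ω k r / B.radialCoeff r - msq) * φ r) r := by
  have h1 : ContDiffOn ℝ 1 (deriv φ) (Set.Ioi B.rp) :=
    h.1.deriv_of_isOpen isOpen_Ioi (by norm_num)
  have h2 : DifferentiableAt ℝ (deriv φ) r :=
    (h1.differentiableOn (by norm_num)).differentiableAt (Ioi_mem_nhds hr)
  have h3 : DifferentiableAt ℝ (fun r => (B.radialCoeff r : ℂ)) r := by
    have : DifferentiableAt ℝ B.radialCoeff r :=
      (((differentiableAt_id.sub_const B.rp).const_mul (B.ν ^ 2 + 3)).mul
        (differentiableAt_id.sub_const B.rm))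
    exact Complex.ofRealCLM.differentiableAt.comp r this
  have h4 : HasDerivAt (fun r => (B.radialCoeff r : ℂ) * deriv φ r)
      (deriv (fun r => (B.radialCoeff r : ℂ) * deriv φ r) r) r := (h3.mul h2).hasDerivAt
  convert h4 using 1
  have := h.radial_eq hr
  linear_combination -this

end StretchedBH
end

/-! ### The reference solution and its Wronskian with a mode. -/

noncomputable section

/-- The function `(r - b)^λ (r - c)^τ` of `r > b, c`; for suitable exponents it has the behaviour
of the pure branches at the horizon and at infinity. -/
def refSol (b c : ℝ) (lam tau : ℂ) (r : ℝ) : ℂ :=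
  Complex.exp (lam * (Real.log (r - b) : ℂ) + tau * (Real.log (r - c) : ℂ))

lemma refSol_ne_zero (b c : ℝ) (lam tau : ℂ) (r : ℝ) : refSol b c lam tau r ≠ 0 :=
  Complex.exp_ne_zero _

lemma hasDerivAt_refSol {b c r : ℝ} (lam tau : ℂ) (hb : b < r) (hc : c < r) :
    HasDerivAt (refSol b c lam tau)
      (refSol b c lam tau r * (lam / ((r - b : ℝ) : ℂ) + tau / ((r - c : ℝ) : ℂ))) r := by
  have h (d : ℝ) (hd : d < r) : HasDerivAt (fun r : ℝ => ((Real.log (r - d) : ℝ) : ℂ))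
      (((1 / (r - d) : ℝ) : ℂ)) r :=
    (((hasDerivAt_id r).sub_const d).log (sub_pos.2 hd).ne').ofReal_comp
  have := (((h b hb).const_mul lam).add ((h c hc).const_mul tau)).cexp
  refine this.congr_deriv ?_
  simp only [refSol, Pi.add_apply]
  push_cast
  ring

/-- The derivative of the Wronskian of `φ` with `g x^n`, where `x = (r - b) / (r - c)` and `g` is
the reference solution. The flux `a (r - b) (r - c) φ'` is written `ψ`. -/
lemma hasDerivAt_wronskian {b c a r : ℝ} {lam tau bet gam : ℂ} {φ ψ : ℝ → ℂ} {φ' ψ' : ℂ}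
    (hb : b < r) (hc : c < r) (htau : tau = -lam - 1 / 2 - bet)
    (hφ : HasDerivAt φ φ' r) (hψ : HasDerivAt ψ ψ' r)
    (hflux : ψ r = (a * (r - b) * (r - c) : ℝ) * φ')
    (hψ' : ψ' = -(a * (1 / 4 - bet ^ 2) - a * (b - c) * lam ^ 2 / (r - b)
      - a * (b - c) * gam ^ 2 / (r - c)) * φ r) (n : ℕ) :
    HasDerivAt (fun r => (((r - b) / (r - c) : ℝ) : ℂ) ^ n *
        ((φ r * (a * (lam * (r - c) + tau * (r - b))) - ψ r) * refSol b c lam tau r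
          + a * (b - c) * n * (φ r * refSol b c lam tau r)))
      (a * (b - c) * (-((1 / 2 + bet + lam + n) ^ 2 + gam ^ 2) *
          (φ r * refSol b c lam tau r / (r - c) * (((r - b) / (r - c) : ℝ) : ℂ) ^ n)
        + n * (n + 2 * lam) *
          (φ r * refSol b c lam tau r / (r - c) * (((r - b) / (r - c) : ℝ) : ℂ) ^ (n - 1)))) r := by
  have hu : ((r : ℂ) - b) ≠ 0 := by exact_mod_cast (sub_pos.2 hb).ne'
  have hv : ((r : ℂ) - c) ≠ 0 := by exact_mod_cast (sub_pos.2 hc).ne'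
  have hg := hasDerivAt_refSol lam tau hb hc
  have hx : HasDerivAt (fun r : ℝ => (((r - b) / (r - c) : ℝ) : ℂ))
      ((((1 * (r - c) - (r - b) * 1) / (r - c) ^ 2 : ℝ) : ℂ)) r :=
    (((hasDerivAt_id r).sub_const b).div ((hasDerivAt_id r).sub_const c)
      (sub_pos.2 hc).ne').ofReal_comp
  have hS : HasDerivAt (fun r : ℝ => (a : ℂ) * (lam * (r - c) + tau * (r - b)))
      (a * (lam * 1 + tau * 1)) r :=
    (((Complex.ofRealCLM.hasDerivAt.sub_const _).const_mul lam).add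
      ((Complex.ofRealCLM.hasDerivAt.sub_const _).const_mul tau)).const_mul _
  have key := (hx.pow n).mul ((((hφ.mul hS).sub hψ).mul hg).add
    ((hφ.mul hg).const_mul ((a : ℂ) * (b - c) * n)))
  refine key.congr_deriv ?_
  simp only [Pi.mul_apply, Pi.add_apply, Pi.sub_apply, Pi.pow_apply]
  rw [hψ', hflux, htau]
  push_cast
  -- For `n = 0` the truncated exponent `n - 1` is harmless, as its term carries the factor `n`.
  rcases n with _ | n
  · simp
    field_simp
    ring
  · simp only [Nat.add_sub_cancel, pow_succ]
    push_cast
    field_simp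
    ring

/-- The modulus is `((r - b)/(r - c))^(Re λ) (r - c)^(-1/2 - Re β)`, where the first factor is at
most `1` and `r - c ≥ b - c`. -/
lemma norm_refSol_le {b c : ℝ} (hcb : c < b) {lam tau bet : ℂ} (hlam : 0 ≤ lam.re)
    (hbet : 0 ≤ bet.re) (htau : tau = -lam - 1 / 2 - bet) {r : ℝ} (hr : b < r) :
    ‖refSol b c lam tau r‖ ≤ Real.exp (-bet.re * Real.log (b - c)) / √(r - c) := by
  have hv : 0 < r - c := by linarith
  have h1 : Real.log (r - b) ≤ Real.log (r - c) :=
    Real.log_le_log (by linarith) (by linarith)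
  have h2 : Real.log (b - c) ≤ Real.log (r - c) :=
    Real.log_le_log (by linarith) (by linarith)
  have h3 : √(r - c) = Real.exp (Real.log (r - c) * (1 / 2)) := by
    rw [Real.sqrt_eq_rpow, Real.rpow_def_of_pos hv]
  have htr : tau.re = -lam.re - 1 / 2 - bet.re := by simp [htau]
  rw [refSol, Complex.norm_exp, h3, ← Real.exp_sub, Real.exp_le_exp]
  simp only [Complex.add_re, Complex.re_mul_ofReal, htr]
  nlinarith [mul_nonneg hlam (sub_nonneg.2 h1), mul_nonneg hbet (sub_nonneg.2 h2)]

/-! ### The tortoise coordinate and the pure branches. -/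

namespace StretchedBH

variable (B : StretchedBH)

/-- The coefficient of the linear term of `4 R²`. -/
def linCoeff : ℝ := (B.ν ^ 2 + 3) * (B.rp + B.rm) - 4 * B.ν * B.shift

/-- The derivative of `R²`. -/
def RsqSlope (r : ℝ) : ℝ := (2 * (3 * (B.ν ^ 2 - 1)) * r + B.linCoeff) / 4

lemma Rsq_eq (r : ℝ) : B.Rsq r = (3 * (B.ν ^ 2 - 1) * r ^ 2 + B.linCoeff * r) / 4 := by
  unfold Rsq linCoeff
  rw [← shift]
  ring

lemma hasDerivAt_Rsq (r : ℝ) : HasDerivAt B.Rsq (B.RsqSlope r) r := by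
  have h : HasDerivAt (fun r : ℝ => (3 * (B.ν ^ 2 - 1) * r ^ 2 + B.linCoeff * r) / 4)
      ((3 * (B.ν ^ 2 - 1) * (((2 : ℕ) : ℝ) * r ^ (2 - 1)) + B.linCoeff * 1) / 4) r :=
    (((hasDerivAt_pow 2 r).const_mul _).add ((hasDerivAt_id r).const_mul _)).div_const 4
  rw [funext B.Rsq_eq]
  convert h using 1
  unfold RsqSlope
  push_cast
  ring

lemma continuous_Rsq : Continuous B.Rsq :=
  continuous_iff_continuousAt.2 fun r => (B.hasDerivAt_Rsq r).continuousAt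

lemma continuous_R : Continuous B.R := B.continuous_Rsq.sqrt

lemma continuous_RsqSlope : Continuous B.RsqSlope := by unfold RsqSlope; fun_prop

lemma continuous_radialCoeff : Continuous B.radialCoeff :=
  (continuous_const.mul (continuous_id.sub continuous_const)).mul
    (continuous_id.sub continuous_const)

lemma tortoise_integrand {r : ℝ} (hr : B.rp < r) :
    1 / (2 * B.R r * B.Nsq r) = 2 * B.R r / B.radialCoeff r := by
  have h1 := (B.R_pos hr.le).ne'
  have h2 := (B.Nsq_pos hr).ne'
  rw [← B.Rsq_mul_Nsq hr.le, ← B.R_sq hr.le]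
  field_simp
  norm_num

lemma continuousOn_tortoise_integrand :
    ContinuousOn (fun r => 1 / (2 * B.R r * B.Nsq r)) (Set.Ioi B.rp) := by
  have : ContinuousOn (fun r => 2 * B.R r / B.radialCoeff r) (Set.Ioi B.rp) :=
    (continuous_const.mul B.continuous_R).continuousOn.div B.continuous_radialCoeff.continuousOn
      fun r hr => (B.radialCoeff_pos hr).ne'
  exact this.congr fun r hr => B.tortoise_integrand hr

lemma hasDerivAt_tortoise {r : ℝ} (hr : B.rp < r) :
    HasDerivAt B.tortoise (2 * B.R r / B.radialCoeff r) r := by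
  rw [← B.tortoise_integrand hr]
  have hsub : Set.uIcc (B.rp + 1) r ⊆ Set.Ioi B.rp := fun s hs =>
    lt_of_lt_of_le (lt_min (lt_add_one _) hr) hs.1
  refine intervalIntegral.integral_hasDerivAt_right
    (B.continuousOn_tortoise_integrand.mono hsub).intervalIntegrable
    (B.continuousOn_tortoise_integrand.stronglyMeasurableAtFilter isOpen_Ioi r hr)
    (B.continuousOn_tortoise_integrand.continuousAt (Ioi_mem_nhds hr))

lemma tortoise_nonneg {r : ℝ} (hr : B.rp + 1 ≤ r) : 0 ≤ B.tortoise r :=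
  intervalIntegral.integral_nonneg hr fun s hs => by
    have hs' : B.rp < s := by linarith [hs.1]
    have := B.R_pos hs'.le
    have := B.Nsq_pos hs'
    positivity

lemma tortoise_nonpos {r : ℝ} (h0 : B.rp < r) (hr : r ≤ B.rp + 1) : B.tortoise r ≤ 0 := by
  rw [tortoise, intervalIntegral.integral_symm, neg_nonpos]
  refine intervalIntegral.integral_nonneg hr fun s hs => ?_
  have hs' : B.rp < s := by linarith [hs.1]
  have := B.R_pos hs'.le
  have := B.Nsq_pos hs'
  positivity

variable {B}

/-- The flux `4 R² N² φ'` where the rescaled radial function is `e^{p r_*} h`. -/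
lemma flux_eq {φ h : ℝ → ℂ} {φ' h' p : ℂ} {r : ℝ} (hr : B.rp < r)
    (hφ : HasDerivAt φ φ' r) (hh : HasDerivAt h h' r) (h0 : h r ≠ 0)
    (heq : B.rescaled φ =ᶠ[𝓝 r] fun r => Complex.exp (p * (B.tortoise r : ℂ)) * h r) :
    (B.radialCoeff r : ℂ) * φ' = φ r * (2 * p * B.R r + B.radialCoeff r * (h' / h r)
      - (B.radialCoeff r * (B.RsqSlope r / (4 * B.Rsq r)) : ℝ)) := by
  have hRsq := B.Rsq_pos hr.le
  have hR := B.R_pos hr.le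
  have hq := Real.sqrt_pos.2 hR
  have hRd : HasDerivAt B.R (B.RsqSlope r / (2 * B.R r)) r := (B.hasDerivAt_Rsq r).sqrt hRsq.ne'
  have hqd : HasDerivAt (fun r => ((√(B.R r) : ℝ) : ℂ))
      ((B.RsqSlope r / (2 * B.R r) / (2 * √(B.R r)) : ℝ) : ℂ) r :=
    (hRd.sqrt hR.ne').ofReal_comp
  have h1 : HasDerivAt (B.rescaled φ) _ r := hqd.mul hφ
  have h2 := (((B.hasDerivAt_tortoise hr).ofReal_comp.const_mul p).cexp.mul hh).congr_of_eventuallyEq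
    heq
  have h3 := h1.unique h2
  have h4 : ((√(B.R r) : ℝ) : ℂ) * φ r = Complex.exp (p * (B.tortoise r : ℂ)) * h r :=
    heq.self_of_nhds
  -- The logarithmic derivative of `R^(1/2)` is a quarter of that of `R²`.
  have h5 : B.RsqSlope r / (2 * B.R r) / (2 * √(B.R r))
      = √(B.R r) * (B.RsqSlope r / (4 * B.Rsq r)) := by
    rw [← B.R_sq hr.le]
    have := Real.sq_sqrt hR.le
    field_simp
    rw [this]
    ring
  rw [h5] at h3
  have hΔ : (B.radialCoeff r : ℂ) ≠ 0 := by exact_mod_cast (B.radialCoeff_pos hr).ne'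
  have hqc : ((√(B.R r) : ℝ) : ℂ) ≠ 0 := by exact_mod_cast hq.ne'
  have h6 : Complex.exp (p * (B.tortoise r : ℂ)) = ((√(B.R r) : ℝ) : ℂ) * φ r / h r := by
    rw [h4]
    field_simp
  rw [h6] at h3
  apply mul_left_cancel₀ hqc
  push_cast at h3 ⊢
  have h7 : ((√(B.R r) : ℝ) : ℂ) * φ' = ((√(B.R r) : ℝ) : ℂ) * φ r / h r *
      (p * (2 * B.R r / B.radialCoeff r)) * h r + ((√(B.R r) : ℝ) : ℂ) * φ r / h r * h'
      - ((√(B.R r) : ℝ) : ℂ) * (B.RsqSlope r / (4 * B.Rsq r)) * φ r := by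
    linear_combination h3
  rw [mul_left_comm, h7]
  field_simp

lemma norm_le_of_rescaled_eq {φ : ℝ → ℂ} {p z : ℂ} {r : ℝ} (hr : B.rp < r)
    (hp : p.re * B.tortoise r ≤ 0)
    (heq : B.rescaled φ r = Complex.exp (p * (B.tortoise r : ℂ)) * z) :
    ‖φ r‖ ≤ ‖z‖ / √(B.R r) := by
  have hq := Real.sqrt_pos.2 (B.R_pos hr.le)
  rw [le_div_iff₀ hq]
  have h1 : ‖B.rescaled φ r‖ = ‖φ r‖ * √(B.R r) := by
    rw [rescaled, norm_mul, Complex.norm_real, Real.norm_eq_abs, abs_of_pos hq, mul_comm]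
  rw [← h1, heq, norm_mul, Complex.norm_exp, Complex.re_mul_ofReal]
  exact mul_le_of_le_one_left (norm_nonneg _) (Real.exp_le_one_iff.2 hp)

end StretchedBH
end

/-! ### Boundary terms at the horizon and at infinity. -/

noncomputable section

namespace StretchedBH

variable {B : StretchedBH}

/-- The flux is `φ L` and `Δ g' = S g`, with `L` and `S` continuous up to `r₊`. Condition `hlamp`
says `L = S` there, so the Wronskian is a bounded function times one tending to `0`. Boundedness of
`φ` uses `Re p ≥ 0` and `r_* ≤ 0` near the horizon. -/
lemma horizon_asymptotics {φ : ℝ → ℂ} {p lam tau bet : ℂ}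
    (hφ : ∀ r, B.rp < r → HasDerivAt φ (deriv φ r) r) (h : B.PureAtHorizon φ p)
    (hp : 0 ≤ p.re) (hlam : 0 ≤ lam.re) (hbet : 0 ≤ bet.re) (htau : tau = -lam - 1 / 2 - bet)
    (hlamp : ((B.ν ^ 2 + 3 : ℝ) : ℂ) * (B.rp - B.rm) * lam = 2 * p * B.R B.rp) :
    (fun r => φ r * refSol B.rp B.rm lam tau r) =O[𝓝[>] B.rp] (fun _ => (1 : ℝ)) ∧
    Tendsto (fun r => (φ r * (((B.ν ^ 2 + 3 : ℝ) : ℂ) * (lam * (r - B.rm) + tau * (r - B.rp)))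
      - B.radialCoeff r * deriv φ r) * refSol B.rp B.rm lam tau r) (𝓝[>] B.rp) (𝓝 0) := by
  obtain ⟨h, han, h0, heq⟩ := h
  have hgt : ∀ᶠ r in 𝓝[>] B.rp, B.rp < r := self_mem_nhdsWithin
  have hcont : ContinuousAt h B.rp := han.continuousAt
  have hRp := B.R_pos le_rfl
  have hgap := B.gap_pos
  have hO : (fun r => φ r * refSol B.rp B.rm lam tau r) =O[𝓝[>] B.rp] (fun _ => (1 : ℝ)) := by
    set K := Real.exp (-bet.re * Real.log (B.rp - B.rm))
    have hlim : ContinuousAt (fun r => ‖h r‖ / √(B.R r) * (K / √(r - B.rm))) B.rp := by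
      have h1 : ContinuousAt (fun r => √(B.R r)) B.rp := B.continuous_R.sqrt.continuousAt
      have h2 : ContinuousAt (fun r => √(r - B.rm)) B.rp := by fun_prop
      exact (hcont.norm.div h1 (Real.sqrt_pos.2 hRp).ne').mul
        (continuousAt_const.div h2 (Real.sqrt_pos.2 hgap).ne')
    refine Asymptotics.IsBigO.trans (Asymptotics.isBigO_iff.2 ⟨1, ?_⟩)
      ((hlim.tendsto.mono_left nhdsWithin_le_nhds).isBigO_one ℝ)
    have hlt : ∀ᶠ r in 𝓝[>] B.rp, r < B.rp + 1 :=
      nhdsWithin_le_nhds (Iio_mem_nhds (lt_add_one _))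
    filter_upwards [hgt, hlt, heq] with r hr hr1 hreq
    have hb := norm_le_of_rescaled_eq hr
      (mul_nonpos_of_nonneg_of_nonpos hp (B.tortoise_nonpos hr hr1.le)) hreq
    have hg := norm_refSol_le B.rm_lt_rp hlam hbet htau hr
    rw [norm_mul, one_mul]
    exact (mul_le_mul hb hg (norm_nonneg _) (by positivity)).trans (le_abs_self _)
  refine ⟨hO, ?_⟩
  set L : ℝ → ℂ := fun r => 2 * p * B.R r + B.radialCoeff r * (deriv h r / h r)
      - (B.radialCoeff r * (B.RsqSlope r / (4 * B.Rsq r)) : ℝ) with hL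
  have hflux : ∀ᶠ r in 𝓝[>] B.rp, (B.radialCoeff r : ℂ) * deriv φ r = φ r * L r := by
    have h1 : ∀ᶠ r in 𝓝[>] B.rp, B.rescaled φ =ᶠ[𝓝 r]
        fun r => Complex.exp (p * (B.tortoise r : ℂ)) * h r := by
      filter_upwards [eventually_eventually_nhdsWithin.2 heq, hgt] with r hr hrp
      rwa [isOpen_Ioi.nhdsWithin_eq hrp] at hr
    have h2 : ∀ᶠ r in 𝓝[>] B.rp, DifferentiableAt ℝ h r :=
      nhdsWithin_le_nhds (han.eventually_analyticAt.mono fun r hr => hr.differentiableAt)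
    have h3 : ∀ᶠ r in 𝓝[>] B.rp, h r ≠ 0 := nhdsWithin_le_nhds (hcont.eventually_ne h0)
    filter_upwards [h1, h2, h3, hgt] with r hr1 hr2 hr3 hr
    exact flux_eq hr (hφ r hr) hr2.hasDerivAt hr3 hr1
  have hT : Tendsto (fun r : ℝ => ((B.ν ^ 2 + 3 : ℝ) : ℂ) * (lam * (r - B.rm) + tau * (r - B.rp))
      - L r) (𝓝[>] B.rp) (𝓝 0) := by
    have hc : ContinuousAt (fun r : ℝ => ((B.ν ^ 2 + 3 : ℝ) : ℂ) *
        (lam * (r - B.rm) + tau * (r - B.rp)) - L r) B.rp := by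
      have hR : Continuous fun r => (B.R r : ℂ) := Complex.continuous_ofReal.comp B.continuous_R
      have hΔ : Continuous fun r => (B.radialCoeff r : ℂ) :=
        Complex.continuous_ofReal.comp B.continuous_radialCoeff
      have h1 : ContinuousAt (fun r => B.radialCoeff r * (B.RsqSlope r / (4 * B.Rsq r))) B.rp :=
        B.continuous_radialCoeff.continuousAt.mul (B.continuous_RsqSlope.continuousAt.div
          (continuous_const.mul B.continuous_Rsq).continuousAt
          (mul_pos four_pos (B.Rsq_pos le_rfl)).ne')
      have h2 : ContinuousAt (fun r => 2 * p * B.R r + B.radialCoeff r * (deriv h r / h r))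
          B.rp :=
        (continuous_const.mul hR).continuousAt.add
          (hΔ.continuousAt.mul (han.deriv.continuousAt.div hcont h0))
      have h3 : Continuous fun r : ℝ => ((B.ν ^ 2 + 3 : ℝ) : ℂ) *
        (lam * (r - B.rm) + tau * (r - B.rp)) := by fun_prop
      exact h3.continuousAt.sub (h2.sub (Complex.continuous_ofReal.continuousAt.comp h1))
    have hΔ0 : B.radialCoeff B.rp = 0 := by simp [radialCoeff]
    have h0 := hc.tendsto
    have hval : ((B.ν ^ 2 + 3 : ℝ) : ℂ) * (lam * (B.rp - B.rm) + tau * (B.rp - B.rp))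
        - L B.rp = 0 := by
      simp only [hL, hΔ0]
      push_cast at hlamp ⊢
      linear_combination hlamp
    rw [hval] at h0
    exact h0.mono_left nhdsWithin_le_nhds
  have hprod := hO.mul_isLittleO ((Asymptotics.isLittleO_one_iff ℝ).2 hT)
  simp only [mul_one] at hprod
  refine ((Asymptotics.isLittleO_one_iff ℝ).1 hprod).congr' ?_
  filter_upwards [hflux] with r hr
  rw [hr]
  ring

variable (B)

lemma tendsto_Rsq_div : Tendsto (fun r => B.Rsq r / r ^ 2) atTop
    (𝓝 (3 * (B.ν ^ 2 - 1) / 4)) := by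
  have h : Tendsto (fun r : ℝ => (3 * (B.ν ^ 2 - 1) + B.linCoeff * r⁻¹) / 4) atTop
      (𝓝 ((3 * (B.ν ^ 2 - 1) + B.linCoeff * 0) / 4)) :=
    ((tendsto_inv_atTop_zero.const_mul _).const_add _).div_const _
  rw [mul_zero, add_zero] at h
  refine h.congr' ?_
  filter_upwards [eventually_gt_atTop 0] with r hr
  rw [B.Rsq_eq]
  field_simp

lemma tendsto_R_div : Tendsto (fun r => B.R r / r) atTop
    (𝓝 (√(3 * (B.ν ^ 2 - 1)) / 2)) := by
  have h := B.tendsto_Rsq_div.sqrt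
  rw [Real.sqrt_div B.stretch_pos.le, show (4 : ℝ) = 2 ^ 2 by norm_num,
    Real.sqrt_sq two_pos.le] at h
  refine h.congr' ?_
  filter_upwards [eventually_gt_atTop B.rp] with r hr
  have hr0 := B.rp_pos.trans hr
  rw [Real.sqrt_div (B.Rsq_pos hr.le).le, Real.sqrt_sq hr0.le, R]

lemma tendsto_RsqSlope_div : Tendsto (fun r => B.RsqSlope r / r) atTop
    (𝓝 (2 * (3 * (B.ν ^ 2 - 1)) / 4)) := by
  have h : Tendsto (fun r : ℝ => (2 * (3 * (B.ν ^ 2 - 1)) + B.linCoeff * r⁻¹) / 4) atTop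
      (𝓝 ((2 * (3 * (B.ν ^ 2 - 1)) + B.linCoeff * 0) / 4)) :=
    ((tendsto_inv_atTop_zero.const_mul _).const_add _).div_const _
  rw [mul_zero, add_zero] at h
  refine h.congr' ?_
  filter_upwards [eventually_gt_atTop 0] with r hr
  unfold RsqSlope
  field_simp

end StretchedBH

lemma tendsto_sub_div_self (c : ℝ) : Tendsto (fun r : ℝ => (r - c) / r) atTop (𝓝 1) := by
  have h : Tendsto (fun r : ℝ => 1 - c * r⁻¹) atTop (𝓝 (1 - c * 0)) :=
    (tendsto_inv_atTop_zero.const_mul c).const_sub 1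
  rw [mul_zero, sub_zero] at h
  refine h.congr' ?_
  filter_upwards [eventually_gt_atTop 0] with r hr
  field_simp

namespace StretchedBH

lemma tendsto_radialCoeff_div (B : StretchedBH) :
    Tendsto (fun r => B.radialCoeff r / r ^ 2) atTop (𝓝 (B.ν ^ 2 + 3)) := by
  have h := ((tendsto_sub_div_self B.rp).const_mul (B.ν ^ 2 + 3)).mul (tendsto_sub_div_self B.rm)
  rw [mul_one, mul_one] at h
  refine h.congr' ?_
  filter_upwards [eventually_gt_atTop 0] with r hr
  unfold radialCoeff
  field_simp

variable {B : StretchedBH}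

/-- Both `φ` and `g` are `O(r^(-1/2))`, the former through the factor `R^(-1/2)`. Here `Δ φ'/φ` and
`Δ g'/g` grow linearly with slopes `E p - (ν² + 3)/2` and `(ν² + 3)(λ + τ)`, where `E = √(3 (ν² -
1))`. The slopes agree by `hbetp` and `htau`, so the Wronskian is `O(1/r)` times `o(r)`. -/
lemma infinity_asymptotics {φ : ℝ → ℂ} {p lam tau bet : ℂ}
    (hφ : ∀ r, B.rp < r → HasDerivAt φ (deriv φ r) r) (h : B.PureAtInfinity φ p)
    (hp : p.re ≤ 0) (hlam : 0 ≤ lam.re) (hbet : 0 ≤ bet.re) (htau : tau = -lam - 1 / 2 - bet)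
    (hbetp : ((B.ν ^ 2 + 3 : ℝ) : ℂ) * bet = -(√(3 * (B.ν ^ 2 - 1)) : ℝ) * p) :
    (fun r => φ r * refSol B.rp B.rm lam tau r) =O[atTop] (fun r : ℝ => r⁻¹) ∧
    Tendsto (fun r => (φ r * (((B.ν ^ 2 + 3 : ℝ) : ℂ) * (lam * (r - B.rm) + tau * (r - B.rp)))
      - B.radialCoeff r * deriv φ r) * refSol B.rp B.rm lam tau r) atTop (𝓝 0) := by
  obtain ⟨h, han, h0, heq⟩ := h
  have hgt : ∀ᶠ r in atTop, B.rp < r := eventually_gt_atTop _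
  have hE := B.stretch_pos
  have hinv : Tendsto (fun r : ℝ => r⁻¹) atTop (𝓝 0) := tendsto_inv_atTop_zero
  have hhlim : Tendsto (fun r : ℝ => h r⁻¹) atTop (𝓝 (h 0)) := han.continuousAt.tendsto.comp hinv
  have hO : (fun r => φ r * refSol B.rp B.rm lam tau r) =O[atTop] (fun r : ℝ => r⁻¹) := by
    set K := Real.exp (-bet.re * Real.log (B.rp - B.rm))
    have hlim : Tendsto (fun r => ‖h r⁻¹‖ / √(B.R r / r) * (K / √((r - B.rm) / r))) atTop
        (𝓝 (‖h 0‖ / √(√(3 * (B.ν ^ 2 - 1)) / 2) * (K / √1))) :=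
      (hhlim.norm.div B.tendsto_R_div.sqrt (by positivity)).mul
        (tendsto_const_nhds.div (tendsto_sub_div_self B.rm).sqrt (by simp))
    have hlim' := (hlim.isBigO_one ℝ).mul (Asymptotics.isBigO_refl (fun r : ℝ => r⁻¹) atTop)
    simp only [one_mul] at hlim'
    refine Asymptotics.IsBigO.trans (Asymptotics.isBigO_iff.2 ⟨1, ?_⟩) hlim'
    filter_upwards [hgt, eventually_ge_atTop (B.rp + 1), heq] with r hr hr1 hreq
    have hr0 := B.rp_pos.trans hr
    have hb := norm_le_of_rescaled_eq hr
      (mul_nonpos_of_nonpos_of_nonneg hp (B.tortoise_nonneg hr1)) hreq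
    have hg : _ ≤ K / √(r - B.rm) := norm_refSol_le B.rm_lt_rp hlam hbet htau hr
    have hRr := B.R_pos hr.le
    have hv : 0 < r - B.rm := by linarith [B.rm_lt_rp]
    rw [norm_mul, one_mul]
    refine (mul_le_mul hb hg (norm_nonneg _) (by positivity)).trans
      (le_of_eq ?_ |>.trans (le_abs_self _))
    rw [Real.sqrt_div hRr.le, Real.sqrt_div hv.le]
    have hs : √r * √r = r := Real.mul_self_sqrt hr0.le
    have hs0 := Real.sqrt_pos.2 hr0
    have hs1 := Real.sqrt_pos.2 hRr
    have hs2 := Real.sqrt_pos.2 hv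
    generalize ‖h r⁻¹‖ = y
    field_simp
    linear_combination -(y * K) * hs
  refine ⟨hO, ?_⟩
  set L : ℝ → ℂ := fun r => 2 * p * B.R r
      + B.radialCoeff r * ((-(r ^ 2)⁻¹ : ℝ) * deriv h r⁻¹ / h r⁻¹)
      - (B.radialCoeff r * (B.RsqSlope r / (4 * B.Rsq r)) : ℝ) with hL
  have hflux : ∀ᶠ r in atTop, (B.radialCoeff r : ℂ) * deriv φ r = φ r * L r := by
    have h1 : ∀ᶠ r in atTop, B.rescaled φ =ᶠ[𝓝 r]
        fun r => Complex.exp (p * (B.tortoise r : ℂ)) * h r⁻¹ := by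
      obtain ⟨M, hM⟩ := eventually_atTop.1 heq
      filter_upwards [eventually_gt_atTop M] with r hr
      filter_upwards [Ioi_mem_nhds hr] with s hs using hM s (le_of_lt hs)
    have h2 : ∀ᶠ r : ℝ in atTop, DifferentiableAt ℝ h r⁻¹ :=
      hinv.eventually (han.eventually_analyticAt.mono fun r hr => hr.differentiableAt)
    have h3 : ∀ᶠ r : ℝ in atTop, h r⁻¹ ≠ 0 := hhlim.eventually_ne h0
    filter_upwards [h1, h2, h3, hgt] with r hr1 hr2 hr3 hr
    have hr0 := B.rp_pos.trans hr
    have hd : HasDerivAt (fun r : ℝ => h r⁻¹) ((-(r ^ 2)⁻¹ : ℝ) * deriv h r⁻¹) r := by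
      have h4 : HasDerivAt (h ∘ fun r : ℝ => r⁻¹) ((-(r ^ 2)⁻¹ : ℝ) • deriv h r⁻¹) r :=
        HasDerivAt.scomp r hr2.hasDerivAt (hasDerivAt_inv hr0.ne')
      rw [Complex.real_smul] at h4
      exact h4
    have h5 := flux_eq (h := fun r => h r⁻¹) hr (hφ r hr) hd hr3 hr1
    rw [h5]
  have hT : Tendsto (fun r : ℝ => (((B.ν ^ 2 + 3 : ℝ) : ℂ) *
      (lam * (r - B.rm) + tau * (r - B.rp)) - L r) * ((r⁻¹ : ℝ) : ℂ)) atTop (𝓝 0) := by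
    have hof : ∀ {f : ℝ → ℝ} {l : ℝ}, Tendsto f atTop (𝓝 l) →
        Tendsto (fun r => ((f r : ℝ) : ℂ)) atTop (𝓝 (l : ℂ)) := fun hf =>
      (Complex.continuous_ofReal.tendsto _).comp hf
    have h1 := (((hof (tendsto_sub_div_self B.rm)).const_mul lam).add
      ((hof (tendsto_sub_div_self B.rp)).const_mul tau)).const_mul ((B.ν ^ 2 + 3 : ℝ) : ℂ)
    have h2 := (hof B.tendsto_R_div).const_mul (2 * p)
    have h3 := ((hof B.tendsto_radialCoeff_div).mul (hof hinv)).mul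
      ((han.deriv.continuousAt.tendsto.comp hinv).div hhlim h0)
    have h4 := hof (B.tendsto_radialCoeff_div.mul (B.tendsto_RsqSlope_div.div
      (B.tendsto_Rsq_div.const_mul 4) (by positivity)))
    have h5 := h1.sub ((h2.sub h3).sub h4)
    have hval : ((B.ν ^ 2 + 3 : ℝ) : ℂ) * (lam * ((1 : ℝ) : ℂ) + tau * ((1 : ℝ) : ℂ))
        - (2 * p * ((√(3 * (B.ν ^ 2 - 1)) / 2 : ℝ) : ℂ)
        - ((B.ν ^ 2 + 3 : ℝ) : ℂ) * ((0 : ℝ) : ℂ) * (deriv h 0 / h 0)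
        - (((B.ν ^ 2 + 3) * (2 * (3 * (B.ν ^ 2 - 1)) / 4 / (4 * (3 * (B.ν ^ 2 - 1) / 4))) : ℝ)
          : ℂ)) = 0 := by
      have : (B.ν ^ 2 + 3) * (2 * (3 * (B.ν ^ 2 - 1)) / 4 / (4 * (3 * (B.ν ^ 2 - 1) / 4)))
          = (B.ν ^ 2 + 3) / 2 := by
        have hne : B.ν ^ 2 - 1 ≠ 0 := by linarith
        field_simp
        norm_num
      rw [this, htau]
      push_cast at hbetp ⊢
      linear_combination -hbetp
    rw [hval] at h5
    refine h5.congr' ?_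
    filter_upwards [hgt] with r hr
    have hr0 : (r : ℂ) ≠ 0 := by exact_mod_cast (B.rp_pos.trans hr).ne'
    have hs0 : (B.Rsq r : ℂ) ≠ 0 := by exact_mod_cast (B.Rsq_pos hr.le).ne'
    simp only [hL, Function.comp_apply, Pi.div_apply]
    generalize deriv h r⁻¹ = y
    generalize h r⁻¹ = z
    push_cast
    field_simp
    ring
  have hO' : (fun r => φ r * refSol B.rp B.rm lam tau r * (r : ℂ)) =O[atTop]
      (fun _ => (1 : ℝ)) := by
    refine (hO.mul (g₂ := fun r : ℝ => r) (f₂ := fun r : ℝ => (r : ℂ))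
      (Asymptotics.isBigO_iff.2 ⟨1, by simp⟩)).congr' EventuallyEq.rfl ?_
    filter_upwards [eventually_gt_atTop 0] with r hr
    exact inv_mul_cancel₀ hr.ne'
  have hprod := hO'.mul_isLittleO ((Asymptotics.isLittleO_one_iff ℝ).2 hT)
  simp only [mul_one] at hprod
  refine ((Asymptotics.isLittleO_one_iff ℝ).1 hprod).congr' ?_
  filter_upwards [hflux, hgt] with r hr hrp
  have hr0 : (r : ℂ) ≠ 0 := by exact_mod_cast (B.rp_pos.trans hrp).ne'
  rw [hr]
  push_cast
  field_simp

end StretchedBH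
end

/-! ### The moment recursion and the vanishing of growing modes. -/

noncomputable section

namespace StretchedBH

open MeasureTheory Set

variable {B : StretchedBH}

/-- Partial fractions: by `four_mul_Rsq`, `freqPoly` is a perfect square at each of `r₊` and `r₋`.
-/
lemma freqPoly_div_radialCoeff (ω : ℂ) (k : ℤ) {r : ℝ} (hr : B.rp < r) :
    B.freqPoly ω k r / B.radialCoeff r =
      3 * (B.ν ^ 2 - 1) * ω ^ 2 / (B.ν ^ 2 + 3)
      + ((2 * B.ν * B.rp - B.shift) * ω + 2 * k) ^ 2 /
        ((B.ν ^ 2 + 3) * (B.rp - B.rm) * (r - B.rp))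
      - ((2 * B.ν * B.rm - B.shift) * ω + 2 * k) ^ 2 /
        ((B.ν ^ 2 + 3) * (B.rp - B.rm) * (r - B.rm)) := by
  have ha : ((B.ν : ℂ) ^ 2 + 3) ≠ 0 := by exact_mod_cast B.warp_pos.ne'
  have hD : ((B.rp : ℂ) - B.rm) ≠ 0 := by exact_mod_cast B.gap_pos.ne'
  have hu : ((r : ℂ) - B.rp) ≠ 0 := by exact_mod_cast (sub_pos.2 hr).ne'
  have hv : ((r : ℂ) - B.rm) ≠ 0 := by
    exact_mod_cast (sub_pos.2 (B.rm_lt_rp.trans hr)).ne'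
  have hs : (B.shift : ℂ) ^ 2 = B.rp * B.rm * (B.ν ^ 2 + 3) := by exact_mod_cast B.shift_sq
  have h4 : 4 * (B.Rsq r : ℂ) = 3 * (B.ν ^ 2 - 1) * r ^ 2
      + ((B.ν ^ 2 + 3) * (B.rp + B.rm) - 4 * B.ν * B.shift) * r := by
    rw [B.Rsq_eq, linCoeff]
    push_cast
    ring
  rw [freqPoly, h4, radialCoeff]
  push_cast
  field_simp
  linear_combination (-(r - B.rm) + (r - B.rp) : ℂ) * ω ^ 2 * hs

/-- A mode solution which is ingoing at the horizon and of the branch `e^{p r_*}` with `Re p ≤ 0`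
at infinity is exponentially damped in time. -/
lemma im_neg_of_pure {msq : ℝ} {ω p : ℂ} {k : ℤ} {φ : ℝ → ℂ}
    (hsol : B.IsModeSolution msq ω k φ)
    (hhor : B.PureAtHorizon φ (-Complex.I * B.omegaTilde ω k))
    (hinf : B.PureAtInfinity φ p) (hpsq : p ^ 2 = B.omegaMsq msq - ω ^ 2)
    (hp : 0 ≤ ω.im → p.re ≤ 0) : ω.im < 0 := by
  by_contra! hω
  replace hp := hp hω
  set a : ℝ := B.ν ^ 2 + 3 with ha
  have ha0 : 0 < a := B.warp_pos
  have hD0 := B.gap_pos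
  have hE := B.stretch_pos
  set E : ℝ := √(3 * (B.ν ^ 2 - 1)) with hEdef
  have hEsq : E ^ 2 = 3 * (B.ν ^ 2 - 1) := Real.sq_sqrt hE.le
  have hE0 : 0 < E := Real.sqrt_pos.2 hE
  have hac : (a : ℂ) ≠ 0 := by exact_mod_cast ha0.ne'
  have hDc : ((B.rp : ℂ) - B.rm) ≠ 0 := by exact_mod_cast hD0.ne'
  set alp : ℂ := ((2 * B.ν * B.rp - B.shift : ℝ) * ω + 2 * k) / ((a * (B.rp - B.rm) : ℝ) : ℂ)
    with halp
  set gam : ℂ := ((2 * B.ν * B.rm - B.shift : ℝ) * ω + 2 * k) / ((a * (B.rp - B.rm) : ℝ) : ℂ)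
    with hgam
  set bet : ℂ := -((E / a : ℝ) : ℂ) * p with hbet
  set lam : ℂ := -Complex.I * alp with hlam
  set tau : ℂ := -lam - 1 / 2 - bet with htau
  have him : ∀ c : ℝ, (((c : ℝ) * ω + 2 * k) / ((a * (B.rp - B.rm) : ℝ) : ℂ)).im
      = c * ω.im / (a * (B.rp - B.rm)) := fun c => by
    rw [Complex.div_ofReal_im]
    simp
  have hbre : 0 ≤ bet.re := by
    rw [hbet, ← Complex.ofReal_neg, Complex.re_ofReal_mul]
    exact mul_nonneg_of_nonpos_of_nonpos (neg_nonpos.2 (by positivity)) hp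
  have haD : 0 < a * (B.rp - B.rm) := mul_pos ha0 hD0
  have hlre : 0 ≤ lam.re := by
    have : lam.re = alp.im := by simp [hlam]
    rw [this, halp, him]
    exact div_nonneg (mul_nonneg (sub_nonneg.2 B.shift_lt.le) hω) haD.le
  -- Zeros of this factor would be the quantized frequencies. With `λ = -iα` it splits over `α ± γ`,
  -- both of nonnegative imaginary part when `Im ω ≥ 0`, so each factor has real part at least
  -- `1/2`.
  have hfac : ∀ n : ℕ, (1 / 2 + bet + lam + n) ^ 2 + gam ^ 2 ≠ 0 := by
    intro n
    have hsum : 0 ≤ (alp + gam).im := by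
      rw [Complex.add_im, halp, hgam, him, him, ← add_div, ← add_mul]
      refine div_nonneg (mul_nonneg ?_ hω) haD.le
      linarith [B.shift_lt_sum]
    have hdiff : 0 ≤ (alp - gam).im := by
      rw [Complex.sub_im, halp, hgam, him, him, ← sub_div, ← sub_mul]
      refine div_nonneg (mul_nonneg ?_ hω) haD.le
      have : 0 < B.ν := by linarith [B.one_lt_ν]
      nlinarith
    have hfactor : (1 / 2 + bet + lam + n) ^ 2 + gam ^ 2
        = (1 / 2 + bet - Complex.I * (alp + gam) + n) * (1 / 2 + bet - Complex.I * (alp - gam) + n)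
        := by
      rw [hlam]
      linear_combination gam ^ 2 * Complex.I_sq
    have hne : ∀ z : ℂ, 0 ≤ z.im → 1 / 2 + bet - Complex.I * z + n ≠ 0 := by
      intro z hz h
      have h' := congrArg Complex.re h
      simp at h'
      have : (0 : ℝ) ≤ n := n.cast_nonneg
      linarith
    rw [hfactor]
    exact mul_ne_zero (hne _ hsum) (hne _ hdiff)
  -- This is the indicial equation at infinity; `ω_m²` is the constant that makes it hold for `β =
  -- -E p/a`.
  have hbsq : (a : ℂ) * (1 / 4 - bet ^ 2) = 3 * (B.ν ^ 2 - 1) * ω ^ 2 / a - msq := by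
    have h1 : (E : ℂ) ^ 2 = 3 * (B.ν ^ 2 - 1) := by exact_mod_cast hEsq
    have h2 : (B.ν : ℂ) ^ 2 - 1 ≠ 0 := by
      have : B.ν ^ 2 - 1 ≠ 0 := by linarith
      exact_mod_cast this
    have h3 : bet ^ 2 = 3 * (B.ν ^ 2 - 1) / a ^ 2 * (B.omegaMsq msq - ω ^ 2) := by
      rw [hbet, ← hpsq, ← h1]
      push_cast
      field_simp
    rw [h3, omegaMsq, ← ha]
    push_cast
    field_simp
    ring
  have hφ : ∀ r, B.rp < r → HasDerivAt φ (deriv φ r) r := fun r hr => hsol.hasDerivAt hr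
  -- The exponents at the horizon match because `R N^θ = 1` at `r₊`.
  have hlamp : ((B.ν ^ 2 + 3 : ℝ) : ℂ) * (B.rp - B.rm) * lam
      = 2 * (-Complex.I * B.omegaTilde ω k) * B.R B.rp := by
    have h1 : (2 * B.R B.rp : ℂ) = 2 * B.ν * B.rp - B.shift := by
      exact_mod_cast B.two_mul_R_rp
    have h2 : (B.R B.rp * B.Nθ B.rp : ℂ) = 1 := by
      have h3 := B.two_Rsq_mul_Nθ le_rfl
      rw [← B.two_mul_R_rp, ← B.R_sq le_rfl] at h3
      have h4 : B.R B.rp * B.Nθ B.rp = 1 := by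
        apply mul_left_cancel₀ (mul_pos two_pos (B.R_pos le_rfl)).ne'
        linear_combination h3
      exact_mod_cast h4
    rw [← ha, hlam, halp, omegaTilde]
    push_cast
    rw [← h1]
    field_simp
    linear_combination (k : ℂ) * h2
  have hbetp : ((B.ν ^ 2 + 3 : ℝ) : ℂ) * bet = -(√(3 * (B.ν ^ 2 - 1)) : ℝ) * p := by
    rw [← ha, ← hEdef, hbet]
    push_cast
    field_simp
  have hpre : 0 ≤ (-Complex.I * B.omegaTilde ω k).re := by
    have : (-Complex.I * B.omegaTilde ω k).re = ω.im := by simp [omegaTilde]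
    rwa [this]
  obtain ⟨hO0, hW0⟩ := horizon_asymptotics hφ hhor hpre hlre hbre htau hlamp
  obtain ⟨hO1, hW1⟩ := infinity_asymptotics hφ hinf hp hlre hbre htau hbetp
  rw [← ha] at hW0 hW1
  set g := refSol B.rp B.rm lam tau with hg
  set X : ℝ → ℂ := fun r => (((r - B.rp) / (r - B.rm) : ℝ) : ℂ) with hX
  set H : ℝ → ℂ := fun r => φ r * g r / (r - B.rm) with hH
  have hvne : ∀ r ∈ Ioi B.rp, ((r : ℂ) - B.rm) ≠ 0 := fun r hr => by
    exact_mod_cast (sub_pos.2 (B.rm_lt_rp.trans hr)).ne'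
  have hsub : ∀ c : ℝ, Continuous fun r : ℝ => (r : ℂ) - c := fun c => by fun_prop
  have hXreal : ContinuousOn (fun r => (r - B.rp) / (r - B.rm)) (Ioi B.rp) :=
    ContinuousOn.div (by fun_prop) (by fun_prop) fun r hr =>
      (sub_pos.2 (B.rm_lt_rp.trans hr)).ne'
  have hXc : ContinuousOn X (Ioi B.rp) := Complex.continuous_ofReal.comp_continuousOn hXreal
  have hHc : ContinuousOn H (Ioi B.rp) := by
    refine ContinuousOn.div (ContinuousOn.mul ?_ ?_) (hsub _).continuousOn hvne
    · exact fun r hr => (hφ r hr).continuousAt.continuousWithinAt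
    · exact fun r hr =>
        (hasDerivAt_refSol lam tau hr (B.rm_lt_rp.trans hr)).continuousAt.continuousWithinAt
  have hHint : IntegrableOn H (Ioi B.rp) := by
    refine integrableOn_Ioi_iff_integrableAtFilter_atTop_nhdsWithin.2 ⟨?_, ?_,
      hHc.locallyIntegrableOn measurableSet_Ioi⟩
    · have h1 : (fun r : ℝ => ((r : ℂ) - B.rm)⁻¹) =O[atTop] (fun r : ℝ => r⁻¹) := by
        have h2 : (fun r : ℝ => ((r - B.rm) / r)⁻¹) =O[atTop] (fun _ => (1 : ℝ)) :=
          ((tendsto_sub_div_self B.rm).inv₀ one_ne_zero).isBigO_one ℝ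
        have h3 := h2.mul (Asymptotics.isBigO_refl (fun r : ℝ => r⁻¹) atTop)
        simp only [one_mul] at h3
        refine Asymptotics.IsBigO.trans (Asymptotics.isBigO_iff.2 ⟨1, ?_⟩) h3
        filter_upwards [eventually_gt_atTop B.rp] with r hr
        have hr0 := (B.rp_pos.trans hr).ne'
        rw [one_mul, inv_div, div_mul_eq_mul_div, mul_inv_cancel₀ hr0, one_div,
          ← Complex.ofReal_sub, ← Complex.ofReal_inv, Complex.norm_real]
      -- One power of `1/r` comes from `φ g`, the other from `1/(r - r₋)`.
      have h4 : H =O[atTop] (fun r : ℝ => r ^ (-2 : ℝ)) := by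
        refine (hO1.mul h1).congr' (Eventually.of_forall fun r => ?_) ?_
        · simp only [hH, div_eq_mul_inv]
        · filter_upwards [eventually_gt_atTop 0] with r hr
          rw [Real.rpow_neg hr.le, ← mul_inv, Real.rpow_two, sq]
      exact h4.integrableAtFilter
        ⟨Ioi B.rp, Ioi_mem_atTop _, hHc.aestronglyMeasurable measurableSet_Ioi⟩
        (integrableAtFilter_rpow_atTop_iff.2 (by norm_num))
    · have h1 : (fun r : ℝ => ((r : ℂ) - B.rm)⁻¹) =O[𝓝[>] B.rp] (fun _ => (1 : ℝ)) :=
        ((((hsub B.rm).tendsto B.rp).inv₀ hDc).mono_left nhdsWithin_le_nhds).isBigO_one ℝ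
      have h4 : H =O[𝓝[>] B.rp] (fun _ => (1 : ℝ)) := by
        refine (hO0.mul h1).congr (fun r => ?_) (fun r => mul_one 1)
        simp only [hH, div_eq_mul_inv]
      exact h4.integrableAtFilter
        ⟨Ioi B.rp, self_mem_nhdsWithin, hHc.aestronglyMeasurable measurableSet_Ioi⟩
        ⟨Ioo B.rp (B.rp + 1), Ioo_mem_nhdsGT (lt_add_one _),
          integrableOn_const (by simp)⟩
  have hXle : ∀ r ∈ Ioi B.rp, ‖X r‖ ≤ 1 := fun r hr => by
    have h1 : 0 < r - B.rp := sub_pos.2 hr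
    have h2 : 0 < r - B.rm := sub_pos.2 (B.rm_lt_rp.trans hr)
    rw [hX, Complex.norm_real, Real.norm_eq_abs, abs_of_nonneg (by positivity), div_le_one h2]
    linarith
  have hHXint : ∀ n : ℕ, IntegrableOn (fun r => H r * X r ^ n) (Ioi B.rp) := by
    intro n
    refine hHint.mul_bdd (c := 1) ((hXc.pow n).aestronglyMeasurable measurableSet_Ioi) ?_
    filter_upwards [ae_restrict_mem measurableSet_Ioi] with r hr
    rw [norm_pow]
    exact pow_le_one₀ (norm_nonneg _) (hXle r hr)
  have hX0 : Tendsto X (𝓝[>] B.rp) (𝓝 0) := by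
    have h1 : ContinuousAt (fun r => (r - B.rp) / (r - B.rm)) B.rp :=
      ContinuousAt.div (by fun_prop) (by fun_prop) hD0.ne'
    have h2 : Tendsto X (𝓝 B.rp) (𝓝 (((B.rp - B.rp) / (B.rp - B.rm) : ℝ) : ℂ)) :=
      (Complex.continuous_ofReal.tendsto _).comp h1.tendsto
    rw [sub_self, zero_div, Complex.ofReal_zero] at h2
    exact h2.mono_left nhdsWithin_le_nhds
  have hφg1 : Tendsto (fun r => φ r * g r) atTop (𝓝 0) :=
    hO1.trans_tendsto tendsto_inv_atTop_zero
  have hrec : ∀ n : ℕ, ((1 / 2 + bet + lam + n) ^ 2 + gam ^ 2) * ∫ r in Ioi B.rp, H r * X r ^ n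
      = n * (n + 2 * lam) * ∫ r in Ioi B.rp, H r * X r ^ (n - 1) := by
    intro n
    have hpot : ∀ r ∈ Ioi B.rp, -(B.freqPoly ω k r / B.radialCoeff r - msq) * φ r
        = -((a : ℂ) * (1 / 4 - bet ^ 2) - a * (B.rp - B.rm) * lam ^ 2 / (r - B.rp)
          - a * (B.rp - B.rm) * gam ^ 2 / (r - B.rm)) * φ r := by
      intro r hr
      have hu : ((r : ℂ) - B.rp) ≠ 0 := by exact_mod_cast (sub_pos.2 (mem_Ioi.1 hr)).ne'
      have hv := hvne r hr
      have hac' : ((B.ν : ℂ) ^ 2 + 3) ≠ 0 := by exact_mod_cast ha0.ne'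
      rw [freqPoly_div_radialCoeff ω k hr, hbsq, hlam, mul_pow, neg_sq, Complex.I_sq, halp, hgam,
        ha]
      push_cast
      congr 2
      field_simp
      ring
    have hder := fun r (hr : r ∈ Ioi B.rp) => hasDerivAt_wronskian (a := a) (gam := gam) hr
      (B.rm_lt_rp.trans hr) htau (hφ r hr) (hsol.hasDerivAt_flux hr) rfl (hpot r hr) n
    have hI := ((hHXint n).const_mul (-((1 / 2 + bet + lam + n) ^ 2 + gam ^ 2))).add
      ((hHXint (n - 1)).const_mul (n * (n + 2 * lam)))
    have hzero := integral_Ioi_eq_zero_of_hasDerivAt hder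
      (hI.const_mul ((a : ℂ) * (B.rp - B.rm))) ?_ ?_
    · rw [integral_const_mul, integral_add ((hHXint n).const_mul _) ((hHXint (n - 1)).const_mul _),
        integral_const_mul, integral_const_mul] at hzero
      have := (mul_eq_zero.1 hzero).resolve_left (mul_ne_zero hac hDc)
      linear_combination -this
    · have hXO : (fun r => X r ^ n) =O[𝓝[>] B.rp] (fun _ => (1 : ℝ)) := (hX0.pow n).isBigO_one ℝ
      have h1 := hXO.mul_isLittleO ((Asymptotics.isLittleO_one_iff ℝ).2 hW0)
      simp only [mul_one] at h1
      have h2 : Tendsto (fun r => X r ^ n * (a * (B.rp - B.rm) * n * (φ r * g r)))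
          (𝓝[>] B.rp) (𝓝 0) := by
        -- Near the horizon `φ g` is only bounded: for `n > 0` the factor `x^n` tends to `0`, for `n
        -- = 0` the coefficient vanishes.
        rcases eq_or_ne n 0 with rfl | hn
        · simp
        · have hXn : Tendsto (fun r => X r ^ n) (𝓝[>] B.rp) (𝓝 0) := by
            simpa [hn] using hX0.pow n
          have h3 := (hO0.const_mul_left ((a : ℂ) * (B.rp - B.rm) * n)).mul_isLittleO
            ((Asymptotics.isLittleO_one_iff ℝ).2 hXn)
          simp only [mul_one] at h3
          exact ((Asymptotics.isLittleO_one_iff ℝ).1 h3).congr fun r => mul_comm _ _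
      have h4 := ((Asymptotics.isLittleO_one_iff ℝ).1 h1).add h2
      rw [add_zero] at h4
      exact h4.congr fun r => (mul_add _ _ _).symm
    · have hXO : (fun r => X r ^ n) =O[atTop] (fun _ => (1 : ℝ)) := by
        refine Asymptotics.isBigO_iff.2 ⟨1, ?_⟩
        filter_upwards [eventually_gt_atTop B.rp] with r hr
        rw [norm_pow, norm_one, mul_one]
        exact pow_le_one₀ (norm_nonneg _) (hXle r hr)
      have h0 := hW1.add (hφg1.const_mul ((a : ℂ) * (B.rp - B.rm) * n))
      rw [mul_zero, add_zero] at h0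
      have h1 := hXO.mul_isLittleO ((Asymptotics.isLittleO_one_iff ℝ).2 h0)
      simp only [mul_one] at h1
      exact (Asymptotics.isLittleO_one_iff ℝ).1 h1
  have hmom : ∀ n : ℕ, ∫ r in Ioi B.rp, H r * X r ^ n = 0 := by
    intro n
    induction n with
    | zero =>
      have := hrec 0
      simp only [Nat.cast_zero, zero_mul] at this
      exact (mul_eq_zero.1 this).resolve_left (by simpa using hfac 0)
    | succ n ih =>
      have := hrec (n + 1)
      rw [Nat.add_sub_cancel, ih, mul_zero] at this
      exact (mul_eq_zero.1 this).resolve_left (hfac (n + 1))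
  have hH0 := eq_zero_of_moments B.rm_lt_rp hHc hHint hmom
  have hφ0 : ∀ r ∈ Ioi B.rp, φ r = 0 := fun r hr => by
    have h := hH0 r hr
    simp only [hH, div_eq_zero_iff, mul_eq_zero] at h
    rcases h with (h | h) | h
    · exact h
    · exact absurd h (refSol_ne_zero _ _ _ _ _)
    · exact absurd h (hvne r hr)
  obtain ⟨h, han, h0, heq⟩ := hhor
  have h1 : ∀ᶠ r in 𝓝[>] B.rp, h r ≠ 0 :=
    nhdsWithin_le_nhds (han.continuousAt.eventually_ne h0)
  obtain ⟨r, hr1, hr2, hr3⟩ := (h1.and (heq.and self_mem_nhdsWithin)).exists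
  rw [rescaled, hφ0 r hr3, mul_zero] at hr2
  exact mul_ne_zero (Complex.exp_ne_zero _) hr1 hr2.symm

end StretchedBH

end

/-! ### Signs of the exponent at infinity for the two kinds of mode. -/

theorem theorem5p2 (B : StretchedBH) (msq : ℝ) (hm : -(B.ν ^ 2 + 3) / 4 ≤ msq) :
    (∀ (ω : ℂ) (k : ℤ) (φ : ℝ → ℂ), B.IsQuasinormalMode msq ω k φ → ω.im < 0) ∧
    (∀ (ω : ℂ) (k : ℤ) (φ : ℝ → ℂ), B.IsBoundStateMode msq ω k φ → ω.im < 0) := by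
  refine ⟨?_, ?_⟩
  · rintro ω k φ ⟨hsol, hhor, ωhat, hsq, hsign, hinf⟩
    refine StretchedBH.im_neg_of_pure hsol hhor hinf ?_ fun hω => ?_
    · rw [mul_pow, Complex.I_sq, hsq]
      ring
    · have h1 := congrArg Complex.im hsq
      simp [sq] at h1
      have h2 : (Complex.I * ωhat).re = -ωhat.im := by simp
      rw [h2, neg_nonpos]
      by_contra! h3
      -- The imaginary part of `ω̂² = ω² - ω_m²` gives `Re ω̂ Im ω̂ = Re ω Im ω`. After
      -- multiplication by `Re ω`, the outgoing condition forces `Im ω̂ ≥ 0`, that is `Re (i ω̂) ≤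
      -- 0`.
      have h4 : ω.re * ωhat.re * ωhat.im = ω.re ^ 2 * ω.im := by
        linear_combination ω.re / 2 * h1
      linarith [mul_neg_of_pos_of_neg hsign h3, mul_nonneg (sq_nonneg ω.re) hω]
  · rintro ω k φ ⟨hsol, hhor, ϖ, hsq, hpos, hinf⟩
    refine StretchedBH.im_neg_of_pure hsol hhor hinf (by rw [neg_sq, hsq]) fun _ => ?_
    simpa using hpos.le
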